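/- For $n\ge 0$ let $\Pi_n$ be the set of set partitions of $\{1,\dots,n\}$. An edge of $\pi\in\Pi_n$ is a pair $(i,j)$, $i<j$, of consecutive elements of one block of $\pi$ (that is, $i$ and $j$ lie in the same block, and no element of that block lies strictly between them). Let $\mathrm{cr}(\pi)$ (resp. $\mathrm{ne}(\pi)$) be the number of pairs of edges $(i_1,j_1),(i_2,j_2)$ of $\pi$ with $i_1<i_2<j_1<j_2$ (resp. $i_1<i_2<j_2<j_1$). Let $[k]_{p,q}=\frac{p^k-q^k}{p-q}=\sum_{i=0}^{k-1}p^iq^{k-1-i}$. Then, as formal power series in $z$, with $p,q$ indeterminates or arbitrary elements of a commutative ring, $$\sum_{n\ge0}\Big(\sum_{\pi\in\Pi_n}p^{\mathrm{cr}(\pi)}q^{\mathrm{ne}(\pi)}\Big)z^n=\sum_{n\ge0}\Big(\sum_{\pi\in\Pi_n}q^{\mathrm{cr}(\pi)}p^{\mathrm{ne}(\pi)}\Big)z^n,$$ and this series has the continued fraction expansion $$\cfrac{1}{1-z-\cfrac{z^2}{1-([1]_{p,q}+1)z-\cfrac{[2]_{p,q}z^2}{1-([2]_{p,q}+1)z-\cfrac{[3]_{p,q}z^2}{1-([3]_{p,q}+1)z-\cfrac{[4]_{p,q}z^2}{\ddots}}}}},$$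 with denominator $1-([k]_{p,q}+1)z$ at level $k\ge0$, followed by the numerator $[k+1]_{p,q}z^2$; that is, for every $n$ the coefficient of $z^n$ in the finite continued fraction truncated at level $N$ (whose innermost denominator is $1-([N]_{p,q}+1)z$) equals that of the series for all sufficiently large $N$. -/

import Mathlib

namespace CrossNest

open PowerSeries

/-- The edges of the partition graph of a set partition `P`: the pairs `(i, j)` with `i < j` such
that `i` and `j` are consecutive elements of the same block. -/
def edges {s : Finset ℕ} (P : Finpartition s) : Finset (ℕ × ℕ) :=
  (s ×ˢ s).filter fun e =>
    ∃ B ∈ P.parts, e.1 ∈ B ∧ e.2 ∈ B ∧ e.1 < e.2 ∧ ∀ k ∈ B, ¬ (e.1 < k ∧ k < e.2)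

/-- The number of crossings: a pair of edges `(i₁, j₁)`, `(i₂, j₂)` with `i₁ < i₂ < j₁ < j₂`.
The inequalities determine which edge is the first one, so no pair is counted twice. -/
def cr {s : Finset ℕ} (P : Finpartition s) : ℕ :=
  ((edges P ×ˢ edges P).filter fun e =>
    e.1.1 < e.2.1 ∧ e.2.1 < e.1.2 ∧ e.1.2 < e.2.2).card

/-- The number of nestings: a pair of edges `(i₁, j₁)`, `(i₂, j₂)` with `i₁ < i₂ < j₂ < j₁`. -/
def ne {s : Finset ℕ} (P : Finpartition s) : ℕ :=
  ((edges P ×ˢ edges P).filter fun e =>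
    e.1.1 < e.2.1 ∧ e.2.1 < e.2.2 ∧ e.2.2 < e.1.2).card

variable {R : Type*} [CommRing R]

/-- The polynomial `∑_π p ^ cr(π) * q ^ ne(π)`, over all set partitions `π` of `{1, …, n}`. -/
def crNePoly (p q : R) (n : ℕ) : R :=
  ∑ P : Finpartition (Finset.Icc 1 n), p ^ cr P * q ^ ne P

/-- `[n]_{p,q} = (p ^ n - q ^ n) / (p - q)`, as a polynomial in `p` and `q`. -/
def pqNat (p q : R) (n : ℕ) : R :=
  ∑ i ∈ Finset.range n, p ^ i * q ^ (n - 1 - i)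

theorem pqNat_mul_sub (p q : R) (n : ℕ) : pqNat p q n * (p - q) = p ^ n - q ^ n :=
  (Commute.all p q).geom_sum₂_mul n

/-- The finite J-fraction with `N + 1` levels, starting at level `k`:
`1 / (1 - b k z - c k z² / (1 - b (k+1) z - c (k+1) z² / (⋯ / (1 - b (k+N) z))))`.
All denominators have constant coefficient `1`, so `invOfUnit · 1` is their inverse. -/
noncomputable def jFractionConvergent (b c : ℕ → R) : ℕ → ℕ → R⟦X⟧
  | 0, k => invOfUnit (1 - C (b k) * X) 1
  | N + 1, k =>
      invOfUnit (1 - C (b k) * X - C (c k) * X ^ 2 * jFractionConvergent b c N (k + 1)) 1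

theorem jFractionConvergent_zero (b c : ℕ → R) (k : ℕ) :
    (1 - C (b k) * X) * jFractionConvergent b c 0 k = 1 := by
  rw [jFractionConvergent]
  exact mul_invOfUnit _ _ (by simp)

theorem jFractionConvergent_succ (b c : ℕ → R) (N k : ℕ) :
    (1 - C (b k) * X - C (c k) * X ^ 2 * jFractionConvergent b c N (k + 1)) *
      jFractionConvergent b c (N + 1) k = 1 := by
  rw [jFractionConvergent]
  exact mul_invOfUnit _ _ (by simp)

/-- The formal power series `F` is given by the infinite J-fraction
`1 / (1 - b 0 z - c 0 z² / (1 - b 1 z - c 1 z² / ⋯))`: its convergents converge to `F` formally,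
that is, every coefficient of `F` is the eventual value of that coefficient of the convergents. -/
def HasJFraction (F : R⟦X⟧) (b c : ℕ → R) : Prop :=
  ∀ n : ℕ, ∃ N₀ : ℕ, ∀ N ≥ N₀, coeff n (jFractionConvergent b c N 0) = coeff n F

end CrossNest

/-! Build a partition by scanning its vertices from left to right, keeping the completed edges `E`
and the set `O` of vertices whose outgoing edge is still open. A new vertex may close one open edge
and may then open one. Closing the edge from `i` makes it cross the open edges starting right of `i`
and nest inside those starting left of `i`. With `k` open edges the choices of `i` thus sum to
`[k]_{p,q}`, whatever `O` is (`sum_pow_card_filter_eq_pqNat`).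

So only `k` matters, and it traces a Motzkin path with up weight `1`, level weight `[k]_{p,q} + 1`
and down weight `[k]_{p,q}` (`diagramSum_succ`). Flajolet's theorem (`hasJFraction_motzkinSeries`)
turns these paths into the J-fraction. The weights are symmetric in `p` and `q`, hence so is the
series. -/

namespace CrossNest

open PowerSeries

/-! ### Motzkin paths and J-fractions -/

/-- One step of the transfer operator of weighted Motzkin paths: up steps have weight `1`, level
steps at height `k` weight `b k`, and down steps from height `k + 1` weight `c k`. -/
def motzkinStep {R : Type*} [CommRing R] (b c : ℕ → R) (g : ℕ → R) : ℕ → R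
  | 0 => g 1 + b 0 * g 0
  | k + 1 => g (k + 2) + b (k + 1) * g (k + 1) + c k * g k

/-- The total weight of the Motzkin paths with `n` steps from height `k` to height `0`. -/
def motzkinWeight {R : Type*} [CommRing R] (b c : ℕ → R) (n : ℕ) : ℕ → R :=
  (motzkinStep b c)^[n] (Pi.single 0 1)

/-- The generating function of `motzkinWeight` by length, for paths starting at height `k`. -/
noncomputable def motzkinSeries {R : Type*} [CommRing R] (b c : ℕ → R) (k : ℕ) : R⟦X⟧ :=
  mk fun n => motzkinWeight b c n k

section Motzkin

variable {R : Type*} [CommRing R] (b c : ℕ → R)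

theorem motzkinWeight_succ (n : ℕ) :
    motzkinWeight b c (n + 1) = motzkinStep b c (motzkinWeight b c n) :=
  Function.iterate_succ_apply' _ _ _

theorem motzkinSeries_zero :
    motzkinSeries b c 0 =
      1 + X * (motzkinSeries b c 1 + C (b 0) * motzkinSeries b c 0) := by
  ext n
  cases n with
  | zero => simp [motzkinSeries, motzkinWeight]
  | succ n =>
    simp [motzkinSeries, motzkinWeight_succ, motzkinStep, coeff_succ_X_mul, coeff_one]

theorem motzkinSeries_succ (k : ℕ) :
    motzkinSeries b c (k + 1) =
      X * (motzkinSeries b c (k + 2) + C (b (k + 1)) * motzkinSeries b c (k + 1) +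
        C (c k) * motzkinSeries b c k) := by
  ext n
  cases n with
  | zero => simp [motzkinSeries, motzkinWeight]
  | succ n => simp [motzkinSeries, motzkinWeight_succ, motzkinStep, coeff_succ_X_mul]

/-- The paths that start at height `k` split at their last visit to height `k`, up to an error
that is invisible in the coefficients of order at most `M`. -/
theorem X_pow_dvd_motzkinSeries_sub (M k : ℕ) (U : R⟦X⟧)
    (hU : motzkinSeries b c k =
      U + X * (motzkinSeries b c (k + 1) + C (b k) * motzkinSeries b c k)) :
    X ^ (M + 1) ∣ motzkinSeries b c k - jFractionConvergent b c M k * U := by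
  induction M generalizing k U with
  | zero =>
    refine ⟨jFractionConvergent b c 0 k * motzkinSeries b c (k + 1), ?_⟩
    linear_combination jFractionConvergent b c 0 k * hU -
      motzkinSeries b c k * jFractionConvergent_zero b c k
  | succ M ih =>
    -- At height `k + 1` the inhomogeneous term is the down step back to `k`, which is why `U` is
    -- arbitrary. Its factor `X` and that of the up step give the `X ^ 2` of the fraction.
    obtain ⟨V, hV⟩ := ih (k + 1) (X * (C (c k) * motzkinSeries b c k))
      ((motzkinSeries_succ b c k).trans (by ring))
    refine ⟨jFractionConvergent b c (M + 1) k * V, ?_⟩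
    linear_combination jFractionConvergent b c (M + 1) k * hU -
      motzkinSeries b c k * jFractionConvergent_succ b c M k +
      X * jFractionConvergent b c (M + 1) k * hV

theorem hasJFraction_motzkinSeries : HasJFraction (motzkinSeries b c 0) b c := by
  intro n
  refine ⟨n, fun N hN => ?_⟩
  have h := X_pow_dvd_motzkinSeries_sub b c N 0 1 (motzkinSeries_zero b c)
  rw [X_pow_dvd_iff] at h
  have := h n (by omega)
  rw [mul_one, map_sub, sub_eq_zero] at this
  exact this.symm

end Motzkin

/-! ### The numbers `[n]_{p,q}` -/

section PQNat

variable {R : Type*} [CommRing R]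

theorem pqNat_comm (p q : R) (n : ℕ) : pqNat p q n = pqNat q p n := by
  unfold pqNat
  rw [← Finset.sum_range_reflect]
  refine Finset.sum_congr rfl fun i hi => ?_
  have := Finset.mem_range.1 hi
  rw [mul_comm, show n - 1 - (n - 1 - i) = i by omega]

theorem pqNat_succ (p q : R) (n : ℕ) : pqNat p q (n + 1) = p * pqNat p q n + q ^ n := by
  unfold pqNat
  rw [Finset.sum_range_succ', Finset.mul_sum]
  congr 1
  · refine Finset.sum_congr rfl fun i hi => ?_
    rw [show n + 1 - 1 - (i + 1) = n - 1 - i by omega, pow_succ]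
    ring
  · simp

/-- A new maximum adds one larger element to each old term, a factor `p`, and its own term is `q ^
s.card`. -/
theorem sum_pow_card_filter_eq_pqNat (p q : R) (O : Finset ℕ) :
    ∑ i ∈ O, p ^ (O.filter (i < ·)).card * q ^ (O.filter (· < i)).card = pqNat p q O.card := by
  induction O using Finset.induction_on_max with
  | empty => simp [pqNat]
  | insert a s h ih =>
    have ha : a ∉ s := fun H => (h a H).false
    rw [Finset.sum_insert ha, Finset.card_insert_of_notMem ha, pqNat_succ, ← ih, add_comm,
      Finset.mul_sum]
    congr 1
    · refine Finset.sum_congr rfl fun i hi => ?_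
      rw [Finset.filter_insert, Finset.filter_insert, if_pos (h i hi), if_neg (h i hi).not_gt,
        Finset.card_insert_of_notMem (by simp [ha]), pow_succ]
      ring
    · rw [Finset.filter_insert, Finset.filter_insert, if_neg (lt_irrefl a),
        Finset.filter_true_of_mem h,
        Finset.filter_false_of_mem fun x hx => (h x hx).not_gt]
      simp

end PQNat


/-! ### Set partitions as edge sets -/

/-- The pairs `(E, O)` of a set `E` of edges on `{1, …, n}` in which every element starts at most
one edge and ends at most one edge, and a set `O` of further elements, which are meant to start
edges whose other end is larger than `n`. -/
structure IsPartialDiagram (n : ℕ) (E : Finset (ℕ × ℕ)) (O : Finset ℕ) : Prop where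
  bounds : ∀ e ∈ E, 1 ≤ e.1 ∧ e.1 < e.2 ∧ e.2 ≤ n
  fst_inj : ∀ e ∈ E, ∀ f ∈ E, e.1 = f.1 → e = f
  snd_inj : ∀ e ∈ E, ∀ f ∈ E, e.2 = f.2 → e = f
  open_bounds : ∀ o ∈ O, 1 ≤ o ∧ o ≤ n
  notMem_open : ∀ e ∈ E, e.1 ∉ O

section Edges

variable {s : Finset ℕ}

theorem mem_edges {P : Finpartition s} {e : ℕ × ℕ} :
    e ∈ edges P ↔ ∃ B ∈ P.parts, e.1 ∈ B ∧ e.2 ∈ B ∧ e.1 < e.2 ∧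
      ∀ k ∈ B, ¬ (e.1 < k ∧ k < e.2) := by
  simp only [edges, Finset.mem_filter, Finset.mem_product, and_iff_right_iff_imp]
  rintro ⟨B, hB, h1, h2, -⟩
  exact ⟨P.subset hB h1, P.subset hB h2⟩

theorem isPartialDiagram_edges {n : ℕ} (P : Finpartition (Finset.Icc 1 n)) :
    IsPartialDiagram n (edges P) ∅ where
  bounds e he := by
    obtain ⟨B, hB, h1, h2, h3, -⟩ := mem_edges.1 he
    have h1' := P.subset hB h1
    have h2' := P.subset hB h2
    simp only [Finset.mem_Icc] at h1' h2'
    omega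
  fst_inj e he f hf h := by
    obtain ⟨B, hB, h1, h2, h3, h4⟩ := mem_edges.1 he
    obtain ⟨B', hB', h1', h2', h3', h4'⟩ := mem_edges.1 hf
    obtain rfl := P.eq_of_mem_parts hB hB' h1 (h ▸ h1')
    have := h4 _ h2'
    have := h4' _ h2
    ext <;> omega
  snd_inj e he f hf h := by
    obtain ⟨B, hB, h1, h2, h3, h4⟩ := mem_edges.1 he
    obtain ⟨B', hB', h1', h2', h3', h4'⟩ := mem_edges.1 hf
    obtain rfl := P.eq_of_mem_parts hB hB' h2 (h ▸ h2')
    have := h4 _ h1'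
    have := h4' _ h1
    ext <;> omega
  open_bounds := by simp
  notMem_open := by simp

/-- The directed graph on `ℕ` with edge set `E`. -/
def Step (E : Finset (ℕ × ℕ)) (a b : ℕ) : Prop := (a, b) ∈ E

open Relation

theorem reflTransGen_step_edges {P : Finpartition s} {B : Finset ℕ} (hB : B ∈ P.parts) {a : ℕ}
    (ha : a ∈ B) (b : ℕ) (hb : b ∈ B) (hab : a ≤ b) : ReflTransGen (Step (edges P)) a b := by
  induction b using Nat.strong_induction_on with
  | _ b ih =>
    obtain rfl | hlt := hab.eq_or_lt
    · exact .refl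
    have hne : (B.filter (· < b)).Nonempty := ⟨a, by simp [ha, hlt]⟩
    obtain ⟨c, hc, hmax⟩ : ∃ c ∈ B.filter (· < b), ∀ k ∈ B.filter (· < b), k ≤ c :=
      ⟨_, Finset.max'_mem _ hne, fun k hk => Finset.le_max' _ k hk⟩
    simp only [Finset.mem_filter] at hc hmax
    refine .tail (ih c hc.2 hc.1 (hmax a ⟨ha, hlt⟩)) (mem_edges.2 ⟨B, hB, hc.1, hb, hc.2, ?_⟩)
    rintro k hk ⟨h1, h2⟩
    exact h1.not_ge (hmax k ⟨hk, h2⟩)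

theorem mem_of_reflTransGen_step_edges {P : Finpartition s} {B : Finset ℕ} (hB : B ∈ P.parts)
    {a b : ℕ} (h : ReflTransGen (Step (edges P)) a b) : a ∈ B ↔ b ∈ B := by
  induction h with
  | refl => rfl
  | tail _ h ih =>
    obtain ⟨B', hB', h1, h2, -⟩ := mem_edges.1 h
    rw [ih]
    constructor
    · intro h'
      obtain rfl := P.eq_of_mem_parts hB hB' h' h1
      exact h2
    · intro h'
      obtain rfl := P.eq_of_mem_parts hB hB' h' h2
      exact h1

/-- The blocks are the connected components of the edge graph, so the edges determine them. -/
theorem parts_subset_of_edges_eq {P Q : Finpartition s} (h : edges P = edges Q) :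
    P.parts ⊆ Q.parts := by
  intro B hB
  obtain ⟨a, ha⟩ := P.nonempty_of_mem_parts hB
  obtain ⟨B', hB', ha'⟩ := Q.exists_mem (P.subset hB ha)
  suffices B = B' by rwa [this]
  ext b
  constructor
  · intro hb
    obtain hab | hab := le_total a b
    · have := reflTransGen_step_edges hB ha b hb hab
      rw [h] at this
      exact (mem_of_reflTransGen_step_edges hB' this).1 ha'
    · have := reflTransGen_step_edges hB hb a ha hab
      rw [h] at this
      exact (mem_of_reflTransGen_step_edges hB' this).2 ha'
  · intro hb
    obtain hab | hab := le_total a b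
    · have := reflTransGen_step_edges hB' ha' b hb hab
      rw [← h] at this
      exact (mem_of_reflTransGen_step_edges hB this).1 ha
    · have := reflTransGen_step_edges hB' hb a ha' hab
      rw [← h] at this
      exact (mem_of_reflTransGen_step_edges hB this).2 ha

theorem edges_injective : Function.Injective (edges (s := s)) := fun _ _ h =>
  Finpartition.ext (subset_antisymm (parts_subset_of_edges_eq h) (parts_subset_of_edges_eq h.symm))

variable {n : ℕ} {E : Finset (ℕ × ℕ)} {O : Finset ℕ}

theorem IsPartialDiagram.le_of_reflTransGen (hE : IsPartialDiagram n E O) {a b : ℕ}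
    (h : ReflTransGen (Step E) a b) : a ≤ b := by
  induction h with
  | refl => rfl
  | tail _ h ih => exact ih.trans (hE.bounds _ h).2.1.le

/-- The equivalence relation whose classes are the chains of edges of `E`. -/
def IsPartialDiagram.setoid (hE : IsPartialDiagram n E O) : Setoid ℕ where
  r a b := ReflTransGen (Step E) a b ∨ ReflTransGen (Step E) b a
  iseqv := by
    -- Out- and in-degrees are at most one, so two chains with a common start or a common end are
    -- comparable; this gives transitivity.
    have hr : Relator.RightUnique (Step E) := fun a b c hb hc =>
      congrArg Prod.snd (hE.fst_inj _ hb _ hc rfl)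
    have hl : Relator.RightUnique (Function.swap (Step E)) := fun a b c hb hc =>
      congrArg Prod.fst (hE.snd_inj _ hb _ hc rfl)
    refine ⟨fun _ => .inl .refl, Or.symm, ?_⟩
    rintro a b c (h1 | h1) (h2 | h2)
    · exact .inl (h1.trans h2)
    · have := ReflTransGen.total_of_right_unique hl
        (reflTransGen_swap.2 h1) (reflTransGen_swap.2 h2)
      exact this.symm.imp reflTransGen_swap.1 reflTransGen_swap.1
    · exact ReflTransGen.total_of_right_unique hr h1 h2
    · exact .inr (h2.trans h1)

/-- The chains of `E` serve as blocks. Edges increase, so consecutive elements of a chain are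
exactly the joined ones. -/
theorem IsPartialDiagram.exists_edges_eq (hE : IsPartialDiagram n E O) :
    ∃ P : Finpartition (Finset.Icc 1 n), edges P = E := by
  classical
  refine ⟨Finpartition.ofSetSetoid hE.setoid _, ?_⟩
  ext ⟨i, j⟩
  have hmem : (i, j) ∈ edges (Finpartition.ofSetSetoid hE.setoid (Finset.Icc 1 n)) ↔
      i ∈ Finset.Icc 1 n ∧ j ∈ Finset.Icc 1 n ∧ i < j ∧ hE.setoid i j ∧
        ∀ k ∈ Finset.Icc 1 n, hE.setoid i k → ¬ (i < k ∧ k < j) := by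
    rw [mem_edges]
    constructor
    · rintro ⟨B, hB, h1, h2, h3, h4⟩
      rw [← Finpartition.part_eq_of_mem _ hB h1] at h2 h4
      rw [Finpartition.mem_part_ofSetSetoid_iff_rel] at h2
      refine ⟨h2.1, h2.2.1, h3, h2.2.2, fun k hk hik => h4 k ?_⟩
      rw [Finpartition.mem_part_ofSetSetoid_iff_rel]
      exact ⟨h2.1, hk, hik⟩
    · rintro ⟨hi, hj, h3, hij, h4⟩
      refine ⟨_, (Finpartition.part_mem _).2 hi, (Finpartition.mem_part_self _).2 hi, ?_, h3, ?_⟩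
      · rw [Finpartition.mem_part_ofSetSetoid_iff_rel]
        exact ⟨hi, hj, hij⟩
      · intro k hk
        rw [Finpartition.mem_part_ofSetSetoid_iff_rel] at hk
        exact h4 k hk.2.1 hk.2.2
  rw [hmem]
  constructor
  · rintro ⟨hi, hj, hlt, h | h, h4⟩
    · obtain rfl | ⟨c, hic, hcj⟩ := ReflTransGen.cases_head h
      · exact absurd hlt (lt_irrefl _)
      · have hb := hE.bounds _ hic
        have hcj' := hE.le_of_reflTransGen hcj
        simp only [Finset.mem_Icc] at hb h4
        have := h4 c (by omega) (.inl (.single hic))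
        obtain rfl : c = j := by omega
        exact hic
    · exact absurd (hE.le_of_reflTransGen h) hlt.not_ge
  · intro h
    have hb := hE.bounds _ h
    simp only [Finset.mem_Icc] at hb ⊢
    refine ⟨by omega, by omega, hb.2.1, .inl (.single h), ?_⟩
    rintro k - (hk | hk) ⟨h1, h2⟩
    -- A chain from `i` to `k` leaves `i` by its only edge `(i, j)`, so `k` cannot be below `j`.
    · obtain rfl | ⟨c, hic, hck⟩ := ReflTransGen.cases_head hk
      · exact lt_irrefl _ h1
      · have := hE.fst_inj _ hic _ h rfl
        have := hE.le_of_reflTransGen hck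
        simp_all
        omega
    · exact absurd (hE.le_of_reflTransGen hk) h1.not_ge

end Edges


/-! ### Adding one vertex to a partial diagram -/

open Classical in
/-- The finite set of all `(E, O)` with `IsPartialDiagram n E O`. -/
noncomputable def partialDiagrams (n : ℕ) : Finset (Finset (ℕ × ℕ) × Finset ℕ) :=
  ((Finset.Icc 1 n ×ˢ Finset.Icc 1 n).powerset ×ˢ (Finset.Icc 1 n).powerset).filter
    fun s => IsPartialDiagram n s.1 s.2

theorem mem_partialDiagrams {n : ℕ} {s : Finset (ℕ × ℕ) × Finset ℕ} :
    s ∈ partialDiagrams n ↔ IsPartialDiagram n s.1 s.2 := by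
  simp only [partialDiagrams, Finset.mem_filter, Finset.mem_product, Finset.mem_powerset,
    and_iff_right_iff_imp]
  intro h
  constructor
  · intro e he
    have := h.bounds e he
    simp only [Finset.mem_product, Finset.mem_Icc]
    omega
  · intro o ho
    exact Finset.mem_Icc.2 (h.open_bounds o ho)

section Recursion

variable {n : ℕ} {E : Finset (ℕ × ℕ)} {O : Finset ℕ}

theorem IsPartialDiagram.mono {m : ℕ} (h : IsPartialDiagram n E O) (hnm : n ≤ m) :
    IsPartialDiagram m E O where
  bounds e he := by have := h.bounds e he; omega
  fst_inj := h.fst_inj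
  snd_inj := h.snd_inj
  open_bounds o ho := by have := h.open_bounds o ho; omega
  notMem_open := h.notMem_open

theorem IsPartialDiagram.open_last (h : IsPartialDiagram (n + 1) E O) :
    IsPartialDiagram (n + 1) E (insert (n + 1) O) where
  bounds := h.bounds
  fst_inj := h.fst_inj
  snd_inj := h.snd_inj
  open_bounds o ho := by
    obtain rfl | ho := Finset.mem_insert.1 ho
    · omega
    · exact h.open_bounds o ho
  notMem_open e he := by
    have := h.bounds e he
    rw [Finset.mem_insert, not_or]
    exact ⟨by omega, h.notMem_open e he⟩

theorem IsPartialDiagram.anti_open {O' : Finset ℕ} (h : IsPartialDiagram n E O) (hO : O' ⊆ O) :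
    IsPartialDiagram n E O' where
  bounds := h.bounds
  fst_inj := h.fst_inj
  snd_inj := h.snd_inj
  open_bounds o ho := h.open_bounds o (hO ho)
  notMem_open e he ho := h.notMem_open e he (hO ho)

theorem IsPartialDiagram.close {i : ℕ} (h : IsPartialDiagram n E O) (hi : i ∈ O) :
    IsPartialDiagram (n + 1) (insert (i, n + 1) E) (O.erase i) where
  bounds e he := by
    have := h.open_bounds i hi
    obtain rfl | he := Finset.mem_insert.1 he
    · simp only; omega
    · have := h.bounds e he; omega
  fst_inj e he f hf hef := by
    obtain rfl | he := Finset.mem_insert.1 he <;> obtain rfl | hf := Finset.mem_insert.1 hf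
    · rfl
    · exact absurd (hef ▸ hi) (h.notMem_open f hf)
    · exact absurd (hef ▸ hi) (h.notMem_open e he)
    · exact h.fst_inj e he f hf hef
  snd_inj e he f hf hef := by
    obtain rfl | he := Finset.mem_insert.1 he <;> obtain rfl | hf := Finset.mem_insert.1 hf
    · rfl
    · have := h.bounds f hf; simp only at hef; omega
    · have := h.bounds e he; simp only at hef; omega
    · exact h.snd_inj e he f hf hef
  open_bounds o ho := by
    have := h.open_bounds o (Finset.mem_of_mem_erase ho); omega
  notMem_open e he ho := by
    obtain rfl | he := Finset.mem_insert.1 he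
    · simp at ho
    · exact h.notMem_open e he (Finset.mem_of_mem_erase ho)

theorem IsPartialDiagram.reopen {i : ℕ} (h : IsPartialDiagram (n + 1) E O)
    (hO : n + 1 ∉ O) (hi : (i, n + 1) ∈ E) :
    IsPartialDiagram n (E.erase (i, n + 1)) (insert i O) where
  bounds e he := by
    obtain ⟨hne, he⟩ := Finset.mem_erase.1 he
    have := h.bounds e he
    have : e.2 ≠ n + 1 := fun H => hne (h.snd_inj _ he _ hi H)
    omega
  fst_inj e he f hf := h.fst_inj e (Finset.mem_of_mem_erase he) f (Finset.mem_of_mem_erase hf)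
  snd_inj e he f hf := h.snd_inj e (Finset.mem_of_mem_erase he) f (Finset.mem_of_mem_erase hf)
  open_bounds o ho := by
    obtain rfl | ho := Finset.mem_insert.1 ho
    · have := h.bounds _ hi; simp only at this; omega
    · have := h.open_bounds o ho
      have : o ≠ n + 1 := fun H => hO (H ▸ ho)
      omega
  notMem_open e he ho := by
    obtain ⟨hne, he⟩ := Finset.mem_erase.1 he
    obtain H | ho := Finset.mem_insert.1 ho
    · exact hne (h.fst_inj _ he _ hi H)
    · exact h.notMem_open e he ho

theorem IsPartialDiagram.of_succ (h : IsPartialDiagram (n + 1) E O) (hO : n + 1 ∉ O)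
    (hE : ∀ i, (i, n + 1) ∉ E) : IsPartialDiagram n E O where
  bounds e he := by
    have := h.bounds e he
    have : e.2 ≠ n + 1 := fun H => hE e.1 (H ▸ he)
    omega
  fst_inj := h.fst_inj
  snd_inj := h.snd_inj
  open_bounds o ho := by
    have := h.open_bounds o ho
    have : o ≠ n + 1 := fun H => hO (H ▸ ho)
    omega
  notMem_open := h.notMem_open

theorem IsPartialDiagram.succ_notMem_open (h : IsPartialDiagram n E O) : n + 1 ∉ O := fun H => by
  have := h.open_bounds _ H
  omega

theorem IsPartialDiagram.pair_succ_notMem (h : IsPartialDiagram n E O) (i : ℕ) :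
    (i, n + 1) ∉ E := fun H => by
  have := h.bounds _ H
  simp only at this
  omega

variable {M : Type*} [AddCommMonoid M]

theorem sum_partialDiagrams_succ_eq_sum_filter (n : ℕ) (f : Finset (ℕ × ℕ) × Finset ℕ → M) :
    ∑ s ∈ partialDiagrams (n + 1), f s =
      ∑ s ∈ (partialDiagrams (n + 1)).filter (fun s => n + 1 ∉ s.2),
        (f s + f (s.1, insert (n + 1) s.2)) := by
  rw [Finset.sum_add_distrib,
    ← Finset.sum_filter_add_sum_filter_not (partialDiagrams (n + 1)) (fun s => n + 1 ∉ s.2)]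
  congr 1
  refine Finset.sum_bij' (fun s _ => (s.1, s.2.erase (n + 1)))
    (fun s _ => (s.1, insert (n + 1) s.2)) ?_ ?_ ?_ ?_ ?_
  · intro s hs
    simp only [Finset.mem_filter, mem_partialDiagrams] at hs ⊢
    exact ⟨hs.1.anti_open (Finset.erase_subset _ _), by simp⟩
  · intro s hs
    simp only [Finset.mem_filter, mem_partialDiagrams] at hs ⊢
    exact ⟨hs.1.open_last, by simp⟩
  · intro s hs
    simp only [Finset.mem_filter, not_not] at hs
    simp [Finset.insert_erase hs.2]
  · intro s hs
    simp only [Finset.mem_filter] at hs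
    simp [Finset.erase_insert hs.2]
  · intro s hs
    simp only [Finset.mem_filter, not_not] at hs
    simp [Finset.insert_erase hs.2]

theorem sum_filter_partialDiagrams_succ (n : ℕ) (f : Finset (ℕ × ℕ) × Finset ℕ → M) :
    ∑ s ∈ (partialDiagrams (n + 1)).filter (fun s => n + 1 ∉ s.2), f s =
      ∑ s ∈ partialDiagrams n,
        (f s + ∑ i ∈ s.2, f (insert (i, n + 1) s.1, s.2.erase i)) := by
  classical
  rw [Finset.sum_add_distrib,
    ← Finset.sum_filter_add_sum_filter_not _ (fun s => ∀ i, (i, n + 1) ∉ s.1)]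
  congr 1
  · refine Finset.sum_congr ?_ fun _ _ => rfl
    ext s
    simp only [Finset.mem_filter, mem_partialDiagrams]
    exact ⟨fun h => h.1.1.of_succ h.1.2 h.2, fun h =>
      ⟨⟨h.mono n.le_succ, h.succ_notMem_open⟩, h.pair_succ_notMem⟩⟩
  · rw [Finset.sum_sigma']
    symm
    refine Finset.sum_bij (fun x _ => (insert (x.2, n + 1) x.1.1, x.1.2.erase x.2)) ?_ ?_ ?_ ?_
    · rintro ⟨s, i⟩ hx
      simp only [Finset.mem_sigma, Finset.mem_filter, mem_partialDiagrams] at hx ⊢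
      refine ⟨⟨hx.1.close hx.2, fun h => ?_⟩, fun h => h i (Finset.mem_insert_self _ _)⟩
      exact hx.1.succ_notMem_open (Finset.mem_of_mem_erase h)
    · rintro ⟨⟨E, O⟩, i⟩ hx ⟨⟨E', O'⟩, i'⟩ hx' h
      simp only [Finset.mem_sigma, mem_partialDiagrams, Prod.mk.injEq] at hx hx' h
      have hi : (i, n + 1) ∈ insert (i', n + 1) E' := h.1 ▸ Finset.mem_insert_self _ _
      obtain rfl : i = i' := by
        simpa [hx'.1.pair_succ_notMem i] using hi
      obtain rfl : E = E' := by
        rw [← Finset.erase_insert (hx.1.pair_succ_notMem i), h.1,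
          Finset.erase_insert (hx'.1.pair_succ_notMem i)]
      obtain rfl : O = O' := by
        rw [← Finset.insert_erase hx.2, h.2, Finset.insert_erase hx'.2]
      rfl
    · rintro ⟨E, O⟩ hs
      simp only [Finset.mem_filter, mem_partialDiagrams, not_forall, not_not] at hs
      obtain ⟨⟨hs, hO⟩, i, hi⟩ := hs
      refine ⟨⟨(E.erase (i, n + 1), insert i O), i⟩, ?_, ?_⟩
      · simp only [Finset.mem_sigma, mem_partialDiagrams]
        exact ⟨hs.reopen hO hi, Finset.mem_insert_self _ _⟩
      · simp only [Finset.insert_erase hi, Finset.erase_insert (hs.notMem_open _ hi)]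
    · intros
      rfl

/-- A partial diagram on `{1, …, n + 1}` arises from one on `{1, …, n}` by either leaving alone or
closing one of the open edges at `n + 1`, and then possibly opening an edge at `n + 1`. -/
theorem sum_partialDiagrams_succ (n : ℕ) (f : Finset (ℕ × ℕ) × Finset ℕ → M) :
    ∑ s ∈ partialDiagrams (n + 1), f s =
      ∑ s ∈ partialDiagrams n,
        (f s + f (s.1, insert (n + 1) s.2) +
          ∑ i ∈ s.2, (f (insert (i, n + 1) s.1, s.2.erase i) +
            f (insert (i, n + 1) s.1, insert (n + 1) (s.2.erase i)))) := by
  rw [sum_partialDiagrams_succ_eq_sum_filter, sum_filter_partialDiagrams_succ]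

end Recursion

/-! ### Crossings and nestings under one step -/

/-- The number of crossings of a partial diagram, counting those with open edges. -/
def diagramCr (E : Finset (ℕ × ℕ)) (O : Finset ℕ) : ℕ :=
  (∑ e ∈ E, ∑ f ∈ E, if e.1 < f.1 ∧ f.1 < e.2 ∧ e.2 < f.2 then 1 else 0) +
    ∑ e ∈ E, ∑ o ∈ O, if e.1 < o ∧ o < e.2 then 1 else 0

/-- The number of nestings of a partial diagram, counting those with open edges. -/
def diagramNe (E : Finset (ℕ × ℕ)) (O : Finset ℕ) : ℕ :=
  (∑ e ∈ E, ∑ f ∈ E, if e.1 < f.1 ∧ f.1 < f.2 ∧ f.2 < e.2 then 1 else 0) +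
    ∑ e ∈ E, ∑ o ∈ O, if o < e.1 then 1 else 0

theorem diagramCr_edges {s : Finset ℕ} (P : Finpartition s) : diagramCr (edges P) ∅ = cr P := by
  simp only [diagramCr, cr, Finset.card_filter, Finset.sum_product, Finset.sum_empty,
    Finset.sum_const_zero, add_zero]

theorem diagramNe_edges {s : Finset ℕ} (P : Finpartition s) : diagramNe (edges P) ∅ = ne P := by
  simp only [diagramNe, ne, Finset.card_filter, Finset.sum_product, Finset.sum_empty,
    Finset.sum_const_zero, add_zero]

section Statistics

variable {n : ℕ} {E : Finset (ℕ × ℕ)} {O : Finset ℕ}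

theorem diagramCr_insert_open (hE : ∀ e ∈ E, e.2 ≤ n + 1) (hO : n + 1 ∉ O) :
    diagramCr E (insert (n + 1) O) = diagramCr E O := by
  unfold diagramCr
  congr 1
  refine Finset.sum_congr rfl fun e he => ?_
  rw [Finset.sum_insert hO, if_neg (by have := hE e he; omega), zero_add]

theorem diagramNe_insert_open (hE : ∀ e ∈ E, e.1 ≤ n + 1) (hO : n + 1 ∉ O) :
    diagramNe E (insert (n + 1) O) = diagramNe E O := by
  unfold diagramNe
  congr 1
  refine Finset.sum_congr rfl fun e he => ?_
  rw [Finset.sum_insert hO, if_neg (by have := hE e he; omega), zero_add]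

/-- Crossings of earlier edges with the edge from `i` were counted while it was open; only those
with open edges starting after `i` are new. -/
theorem IsPartialDiagram.diagramCr_close (h : IsPartialDiagram n E O) {i : ℕ} (hi : i ∈ O) :
    diagramCr (insert (i, n + 1) E) (O.erase i) =
      diagramCr E O + (O.filter (i < ·)).card := by
  have hn := h.pair_succ_notMem i
  have h1 : ∀ e ∈ E, (if e.1 < i ∧ i < e.2 ∧ e.2 < n + 1 then 1 else 0) =
      if e.1 < i ∧ i < e.2 then 1 else 0 := fun e he => by
    have := h.bounds e he
    exact if_congr (by omega) rfl rfl
  have h2 : ∑ f ∈ E, (if i < f.1 ∧ f.1 < n + 1 ∧ n + 1 < f.2 then 1 else 0) = 0 :=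
    Finset.sum_eq_zero fun e he => if_neg (by have := h.bounds e he; omega)
  have h3 : ∑ o ∈ O.erase i, (if i < o ∧ o < n + 1 then 1 else 0) =
      (O.filter (i < ·)).card := by
    rw [Finset.card_filter, ← Finset.add_sum_erase O _ hi, if_neg (lt_irrefl i), zero_add]
    refine Finset.sum_congr rfl fun o ho => if_congr ?_ rfl rfl
    have := h.open_bounds o (Finset.mem_of_mem_erase ho)
    omega
  simp only [diagramCr, Finset.sum_insert hn, h2, h3, lt_irrefl, and_false, if_false,
    Finset.sum_add_distrib, Finset.sum_congr rfl h1, ← Finset.add_sum_erase O _ hi]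
  ring

theorem IsPartialDiagram.diagramNe_close (h : IsPartialDiagram n E O) {i : ℕ} (hi : i ∈ O) :
    diagramNe (insert (i, n + 1) E) (O.erase i) =
      diagramNe E O + (O.filter (· < i)).card := by
  have hn := h.pair_succ_notMem i
  have h1 : ∑ e ∈ E, (if e.1 < i ∧ i < n + 1 ∧ n + 1 < e.2 then 1 else 0) = 0 :=
    Finset.sum_eq_zero fun e he => if_neg (by have := h.bounds e he; omega)
  have h2 : ∀ f ∈ E, (if i < f.1 ∧ f.1 < f.2 ∧ f.2 < n + 1 then 1 else 0) =
      if i < f.1 then 1 else 0 := fun e he => by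
    have := h.bounds e he
    exact if_congr (by omega) rfl rfl
  have h3 : ∑ o ∈ O.erase i, (if o < i then 1 else 0) = (O.filter (· < i)).card := by
    rw [Finset.card_filter, ← Finset.add_sum_erase O _ hi, if_neg (lt_irrefl i), zero_add]
  simp only [diagramNe, Finset.sum_insert hn, h1, h3, lt_irrefl, and_false, if_false,
    Finset.sum_add_distrib, Finset.sum_congr rfl h2, ← Finset.add_sum_erase O _ hi]
  ring

end Statistics

/-! ### Transfer to weighted Motzkin paths -/

section Weights

variable {R : Type*} [CommRing R] (p q : R)

/-- The sum over all partial diagrams with `n` vertices, weighted by crossings and nestings and by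
a function `g` of the number of open edges. -/
noncomputable def diagramSum (n : ℕ) (g : ℕ → R) : R :=
  ∑ s ∈ partialDiagrams n, p ^ diagramCr s.1 s.2 * q ^ diagramNe s.1 s.2 * g s.2.card

theorem diagramSum_zero (g : ℕ → R) : diagramSum p q 0 g = g 0 := by
  have : partialDiagrams 0 = {(∅, ∅)} := by
    ext s
    simp only [mem_partialDiagrams, Finset.mem_singleton]
    constructor
    · intro h
      refine Prod.ext (Finset.eq_empty_of_forall_notMem fun e he => ?_)
        (Finset.eq_empty_of_forall_notMem fun o ho => ?_)
      · have := h.bounds e he; omega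
      · have := h.open_bounds o ho; omega
    · rintro rfl
      constructor <;> simp
  simp [diagramSum, this, diagramCr, diagramNe]

theorem diagramSum_succ (n : ℕ) (g : ℕ → R) :
    diagramSum p q (n + 1) g = diagramSum p q n
      (motzkinStep (fun k => pqNat p q k + 1) (fun k => pqNat p q (k + 1)) g) := by
  unfold diagramSum
  rw [sum_partialDiagrams_succ]
  refine Finset.sum_congr rfl fun s hs => ?_
  obtain ⟨E, O⟩ := s
  have h : IsPartialDiagram n E O := mem_partialDiagrams.1 hs
  have hO := h.succ_notMem_open
  have hclose : ∀ i ∈ O,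
      p ^ diagramCr (insert (i, n + 1) E) (O.erase i) *
          q ^ diagramNe (insert (i, n + 1) E) (O.erase i) * g (O.erase i).card +
        p ^ diagramCr (insert (i, n + 1) E) (insert (n + 1) (O.erase i)) *
          q ^ diagramNe (insert (i, n + 1) E) (insert (n + 1) (O.erase i)) *
          g (insert (n + 1) (O.erase i)).card =
      p ^ (O.filter (i < ·)).card * q ^ (O.filter (· < i)).card *
        (p ^ diagramCr E O * q ^ diagramNe E O * (g (O.card - 1) + g O.card)) := by
    intro i hi
    have hc := h.close hi
    have hO' : n + 1 ∉ O.erase i := fun H => hO (Finset.mem_of_mem_erase H)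
    rw [diagramCr_insert_open (fun e he => (hc.bounds e he).2.2) hO',
      diagramNe_insert_open (fun e he => by have := hc.bounds e he; omega) hO',
      h.diagramCr_close hi, h.diagramNe_close hi, Finset.card_insert_of_notMem hO',
      Finset.card_erase_add_one hi, Finset.card_erase_of_mem hi]
    ring
  simp only
  rw [Finset.sum_congr rfl hclose, ← Finset.sum_mul, sum_pow_card_filter_eq_pqNat,
    diagramCr_insert_open (fun e he => by have := h.bounds e he; omega) hO,
    diagramNe_insert_open (fun e he => by have := h.bounds e he; omega) hO,
    Finset.card_insert_of_notMem hO]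
  -- For empty `O`, `[0]_{p,q} = 0` removes the term with the truncated `O.card - 1`.
  cases O.card with
  | zero => simp [motzkinStep, pqNat]; ring
  | succ k => simp only [motzkinStep, Nat.add_sub_cancel]; ring

theorem diagramSum_eq (n : ℕ) (g : ℕ → R) :
    diagramSum p q n g =
      (motzkinStep (fun k => pqNat p q k + 1) (fun k => pqNat p q (k + 1)))^[n] g 0 := by
  induction n generalizing g with
  | zero => exact diagramSum_zero p q g
  | succ n ih => rw [diagramSum_succ, ih, Function.iterate_succ_apply]

/-- `Pi.single 0 1` keeps the diagrams without open edges, which are the edge sets of partitions. -/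
theorem crNePoly_eq_diagramSum (n : ℕ) :
    crNePoly p q n = diagramSum p q n (Pi.single 0 1) := by
  have : diagramSum p q n (Pi.single 0 1) =
      ∑ s ∈ (partialDiagrams n).filter (fun s => s.2 = ∅),
        p ^ diagramCr s.1 s.2 * q ^ diagramNe s.1 s.2 := by
    simp [diagramSum, Finset.sum_filter, Pi.single_apply]
  rw [this]
  refine Finset.sum_bij (fun P _ => (edges P, ∅)) ?_ ?_ ?_ ?_
  · intro P _
    simpa [mem_partialDiagrams] using isPartialDiagram_edges P
  · intro P _ Q _ h
    exact edges_injective (Prod.mk.inj h).1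
  · rintro ⟨E, O⟩ hs
    simp only [Finset.mem_filter, mem_partialDiagrams] at hs
    obtain ⟨h, rfl⟩ := hs
    obtain ⟨P, hP⟩ := h.exists_edges_eq
    exact ⟨P, Finset.mem_univ _, by rw [hP]⟩
  · intro P _
    rw [diagramCr_edges, diagramNe_edges]

theorem crNePoly_eq_motzkinWeight (n : ℕ) :
    crNePoly p q n =
      motzkinWeight (fun k => pqNat p q k + 1) (fun k => pqNat p q (k + 1)) n 0 := by
  rw [crNePoly_eq_diagramSum, diagramSum_eq, motzkinWeight]

theorem crNePoly_comm (n : ℕ) : crNePoly p q n = crNePoly q p n := by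
  simp only [crNePoly_eq_motzkinWeight, pqNat_comm p q]

end Weights

end CrossNest

theorem mainTheorem8 {R : Type*} [CommRing R] (p q : R) :
    PowerSeries.mk (fun n => CrossNest.crNePoly p q n) =
        PowerSeries.mk (fun n => CrossNest.crNePoly q p n) ∧
      CrossNest.HasJFraction (PowerSeries.mk (fun n => CrossNest.crNePoly p q n))
        (fun k => CrossNest.pqNat p q k + 1) (fun k => CrossNest.pqNat p q (k + 1)) := by
  refine ⟨by simp only [CrossNest.crNePoly_comm p q], ?_⟩
  simp only [CrossNest.crNePoly_eq_motzkinWeight]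
  exact CrossNest.hasJFraction_motzkinSeries _ _
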